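/- Let $d\ge 1$ be an integer and let $\mathbb S^d\subset\mathbb R^{d+1}$ be the unit sphere, with geodesic distance $\vartheta(x,y)=\arccos(x^\top y)\in[0,\pi]$. For $\lambda>0$ let $G_n^{\lambda}$ ($n\in\mathbb N=\{0,1,2,\dots\}$) be the Gegenbauer polynomials, given by $G_0^\lambda(r)=1$, $G_1^\lambda(r)=2\lambda r$ and $G_n^\lambda(r)=\frac{2(n+\lambda-1)}{n}\,r\,G_{n-1}^\lambda(r)-\frac{n+2\lambda-2}{n}\,G_{n-2}^\lambda(r)$ for $n>1$; let $G_n^0$ be the Chebyshev polynomial with $G_n^0(\cos\vartheta)=\cos(n\vartheta)$. Let $(b_{n,d})_{n\in\mathbb N}$ be a Schoenberg sequence, that is, $b_{n,d}\ge 0$ for all $n$ and $\sum_{n} b_{n,d}\,G_n^{(d-1)/2}(1)<\infty$. A real random field $Z=\{Z(x):x\in\mathbb S^d\}$ with finite second moments is called isotropic if its mean is constant and $\operatorname{cov}\{Z(x),Z(y)\}=K(\vartheta(x,y))$ for all $x,y\in\mathbb S^d$, for some continuous function $K:[0,\pi]\to\mathbb R$, which is called the isotropic part of the covariance function. Let $\varepsilon$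 be a real random variable with zero mean and unit variance, $\omega$ a random vector uniformly distributed on $\mathbb S^d$, and $\kappa$ an $\mathbb N$-valued random variable with $\mathbb P(\kappa=n)=a_n$, $n\in\mathbb N$. Suppose that the support of $(a_n)$ contains the support of $(b_{n,d})$ and that $\varepsilon,\omega,\kappa$ are (mutually) independent. (1) Let $d=1$. Put $c_0=1$ and $c_n=2$ for $n\ge1$. The random field $$Z(x)=\varepsilon\sqrt{\frac{c_\kappa\, b_{\kappa,1}}{a_\kappa}}\;\cos(\kappa\,\vartheta(\omega,x)),\qquad x\in\mathbb S^1,$$ is isotropic, with zero mean and covariance function with isotropic part $K(\vartheta)=\sum_{n=0}^\infty b_{n,1}\cos(n\vartheta)$, $0\le\vartheta\le\pi$, where the series converges. If $c_0=1$ is replaced by $c_0=2$, then the random field is still isotropic with zero mean, and the isotropic part of its covariance function is $b_{0,1}+K(\vartheta)$; it is therefore $K(\vartheta)$ when $b_{0,1}=0$. (2) Let $d\ge2$. The random field $$Z(x)=\varepsilon\sqrt{\frac{b_{\kappa,d}\,(2\kappa+d-1)}{a_\kappa\,(d-1)}}\;G_\kappa^{(d-1)/2}(\omega^\top x),\qquad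 x\in\mathbb S^d,$$ is isotropic, with zero mean and covariance function with isotropic part $K(\vartheta)=\sum_{n=0}^\infty b_{n,d}\,G_n^{(d-1)/2}(\cos\vartheta)$, $0\le\vartheta\le\pi$, where the series converges. -/

import Mathlib

open MeasureTheory ProbabilityTheory

noncomputable section

/-- The three-term recurrence of the Gegenbauer polynomials of parameter `lam`:
`G₀ = 1`, `G₁ = 2 lam r`,
`Gₙ = (2 (n + lam - 1) / n) r Gₙ₋₁ - ((n + 2 lam - 2) / n) Gₙ₋₂` for `n > 1`
(written below with `n + 2` in place of `n`). -/
def gegenbauerRec (lam : ℝ) : ℕ → Polynomial ℝ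
  | 0 => 1
  | 1 => Polynomial.C (2 * lam) * Polynomial.X
  | n + 2 =>
      Polynomial.C (2 * ((n : ℝ) + 1 + lam) / ((n : ℝ) + 2)) * Polynomial.X
          * gegenbauerRec lam (n + 1)
        - Polynomial.C (((n : ℝ) + 2 * lam) / ((n : ℝ) + 2)) * gegenbauerRec lam n

open Classical in
/-- The Gegenbauer polynomial `G_n^lam`, with the usual convention that `G_n^0` is the Chebyshev
polynomial of the first kind, i.e. `G_n^0 (cos θ) = cos (n θ)`. -/
def gegenbauer (lam : ℝ) (n : ℕ) : Polynomial ℝ :=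
  if lam = 0 then Polynomial.Chebyshev.T ℝ (n : ℤ) else gegenbauerRec lam n

/-- The `d`-dimensional unit sphere of `ℝ^(d+1)`. -/
abbrev UnitSphere (d : ℕ) : Type :=
  Metric.sphere (0 : EuclideanSpace ℝ (Fin (d + 1))) 1

/-- The uniform probability measure on the `d`-sphere: the surface measure divided by its mass. -/
def sphereUniform (d : ℕ) : Measure (UnitSphere d) :=
  ((volume : Measure (EuclideanSpace ℝ (Fin (d + 1)))).toSphere Set.univ)⁻¹ •
    (volume : Measure (EuclideanSpace ℝ (Fin (d + 1)))).toSphere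

/-- The scalar product `xᵀ y` of two points of the sphere. -/
def sphereInner {d : ℕ} (x y : UnitSphere d) : ℝ :=
  inner ℝ (x : EuclideanSpace ℝ (Fin (d + 1))) (y : EuclideanSpace ℝ (Fin (d + 1)))

/-- The geodesic distance `arccos (xᵀ y)` on the sphere. -/
def geodesicDist {d : ℕ} (x y : UnitSphere d) : ℝ :=
  Real.arccos (sphereInner x y)

/-- Schoenberg sequences on the `d`-sphere: nonnegative sequences `b` with
`∑ b_n G_n^((d-1)/2) (1) < ∞`. -/
structure IsSchoenbergSequence (d : ℕ) (b : ℕ → ℝ) : Prop where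
  nonneg : ∀ n, 0 ≤ b n
  summable : Summable fun n => b n * (gegenbauer (((d : ℝ) - 1) / 2) n).eval 1

/-- `K`, a continuous function on `[0, π]`, is the isotropic part of the covariance function
of the random field `Z` on the sphere. -/
structure IsIsotropicPart {Ω : Type*} [MeasurableSpace Ω] (μ : Measure Ω) {d : ℕ}
    (Z : UnitSphere d → Ω → ℝ) (K : ℝ → ℝ) : Prop where
  continuousOn : ContinuousOn K (Set.Icc 0 Real.pi)
  covariance_eq : ∀ x y, covariance (Z x) (Z y) μ = K (geodesicDist x y)

/-- A (weakly) isotropic random field on the sphere: finite second-order moments, constant mean,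
and a covariance that is a continuous function of the geodesic distance. -/
structure IsIsotropic {Ω : Type*} [MeasurableSpace Ω] (μ : Measure Ω) {d : ℕ}
    (Z : UnitSphere d → Ω → ℝ) : Prop where
  memLp : ∀ x, MemLp (Z x) 2 μ
  constant_mean : ∃ m : ℝ, ∀ x, ∫ w, Z x w ∂μ = m
  exists_isotropicPart : ∃ K : ℝ → ℝ, IsIsotropicPart μ Z K

/-- The cosine wave with weights `c`:
`Z(x) = ε sqrt (c_κ b_κ / a_κ) cos (κ ϑ(ω, x))`. -/
def cosineWave {Ω : Type*} {d : ℕ} (c a b : ℕ → ℝ) (ε : Ω → ℝ) (ω : Ω → UnitSphere d)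
    (κ : Ω → ℕ) (x : UnitSphere d) (w : Ω) : ℝ :=
  ε w * Real.sqrt (c (κ w) * b (κ w) / a (κ w)) * Real.cos ((κ w : ℝ) * geodesicDist (ω w) x)

/-- The Gegenbauer wave
`Z(x) = ε sqrt (b_κ (2κ + d - 1) / (a_κ (d - 1))) G_κ^((d-1)/2) (ωᵀ x)`. -/
def gegenbauerWave {Ω : Type*} {d : ℕ} (a b : ℕ → ℝ) (ε : Ω → ℝ) (ω : Ω → UnitSphere d)
    (κ : Ω → ℕ) (x : UnitSphere d) (w : Ω) : ℝ :=
  ε w * Real.sqrt (b (κ w) * (2 * (κ w : ℝ) + (d : ℝ) - 1) / (a (κ w) * ((d : ℝ) - 1)))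
    * (gegenbauer (((d : ℝ) - 1) / 2) (κ w)).eval (sphereInner (ω w) x)

end

/-! The wave is `ε` times a function of `(ω, κ)`. As `ε` is centred, has unit variance and is
independent of `(ω, κ)`, the mean vanishes and the covariance is the mean product of that function
at `x` and `y`. Given `κ = n`, this product is governed by the reproducing identity `∫ P(o·x) P(o·y)
dσ(o) = γ P(x·y)`, where `P` is the Chebyshev or Gegenbauer polynomial of degree `n` and `γ = γ n`
depends only on `n` and `d`. The weight under the root is `b n / (a n * γ n)` wherever `a n ≠ 0`, so
averaging over `κ` leaves `∑ b n P_n(x·y)`.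

The reproducing identity is obtained without spherical harmonics. Integration by parts on the sphere
(`sphereForm_X_mul`, derived from Gaussian moments) makes the Gegenbauer operator self-adjoint for
the pairing of zonal functions with two different poles. Different degrees are then orthogonal, and
the diagonal pairings inherit the three-term recurrence evaluated at `x·y` (`bilinear_self`). The
identity also gives `|P| ≤ P(1)` on `[-1, 1]` (`abs_eval_le_eval_one`), hence convergence and
continuity of the series. `isIsotropic_of_eq_zonalWave` treats all the waves at once. -/

noncomputable section

/-! ### Gegenbauer polynomials normalized at `1`: recurrences and differential equation. -/

open Polynomial in
/-- The zonal polynomials of the `d`-sphere, normalized to take the value `1` at `1`. -/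
def zonalPoly (d : ℝ) : ℕ → Polynomial ℝ
  | 0 => 1
  | 1 => X
  | n + 2 => C ((2 * (n : ℝ) + 1 + d) / ((n : ℝ) + d)) * X * zonalPoly d (n + 1)
      - C (((n : ℝ) + 1) / ((n : ℝ) + d)) * zonalPoly d n

/-- The mean square of the zonal polynomial of degree `n` over the `d`-sphere. -/
def zonalNormSq (d : ℝ) : ℕ → ℝ
  | 0 => 1
  | 1 => 1 / (d + 1)
  | n + 2 => (2 * (n : ℝ) + d + 1) * ((n : ℝ) + 2) / (((n : ℝ) + d) * (2 * (n : ℝ) + d + 3))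
      * zonalNormSq d (n + 1)

namespace zonalPoly

open Polynomial

variable {d : ℝ}

theorem natCast_add_C_ne_zero (hd : 1 ≤ d) (n : ℕ) : (n : ℝ[X]) + C d ≠ 0 := by
  have h : (n : ℝ[X]) + C d = C ((n : ℝ) + d) := by simp
  rw [h]
  have : (0 : ℝ) < n + d := by positivity
  exact C_ne_zero.2 this.ne'

theorem recurrence (hd : 1 ≤ d) (n : ℕ) :
    ((n : ℝ[X]) + C d) * zonalPoly d (n + 2) =
      (2 * (n : ℝ[X]) + 1 + C d) * X * zonalPoly d (n + 1) - ((n : ℝ[X]) + 1) * zonalPoly d n := by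
  have hn : (n : ℝ) + d ≠ 0 := by positivity
  have e : (n : ℝ[X]) + C d = C ((n : ℝ) + d) := by simp
  have e1 : (2 * (n : ℝ[X]) + 1 + C d) = C (2 * (n : ℝ) + 1 + d) := by simp [map_ofNat C 2]
  have e2 : ((n : ℝ[X]) + 1) = C ((n : ℝ) + 1) := by simp
  rw [e, e1, e2, zonalPoly, mul_sub, ← mul_assoc, ← mul_assoc, ← mul_assoc, ← C_mul, ← C_mul,
    mul_div_cancel₀ _ hn, mul_div_cancel₀ _ hn]

/-- The two relations feed each other in the induction, so they are proved jointly; the link is the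
derivative of the three-term recurrence. -/
theorem derivative_relations (hd : 1 ≤ d) (n : ℕ) :
    ((n : ℝ[X]) + 1) * derivative (zonalPoly d n) =
        ((n : ℝ[X]) + C d - 1) *
          (X * derivative (zonalPoly d (n + 1)) - ((n : ℝ[X]) + 1) * zonalPoly d (n + 1)) ∧
      (1 - X ^ 2) * derivative (zonalPoly d (n + 1)) =
        ((n : ℝ[X]) + 1) * (zonalPoly d n - X * zonalPoly d (n + 1)) := by
  induction n with
  | zero => constructor <;> simp [zonalPoly]; ring
  | succ n ih =>
    obtain ⟨ha, hc⟩ := ih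
    have R := recurrence hd n
    have hR := congrArg derivative R
    simp only [derivative_mul, derivative_sub, derivative_add, derivative_C, derivative_X,
      derivative_natCast, derivative_one, derivative_ofNat] at hR
    have hb : ((n : ℝ[X]) + C d) * derivative (zonalPoly d (n + 2)) = ((n : ℝ[X]) + 2) *
        (X * derivative (zonalPoly d (n + 1)) + ((n : ℝ[X]) + C d) * zonalPoly d (n + 1)) := by
      linear_combination hR - ha
    push_cast
    constructor
    · linear_combination -X * hb + ((n : ℝ[X]) + 2) * hc + ((n : ℝ[X]) + 2) * R
    · refine mul_left_cancel₀ (natCast_add_C_ne_zero hd n) ?_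
      linear_combination (1 - X ^ 2) * hb + ((n : ℝ[X]) + 2) * X * hc + ((n : ℝ[X]) + 2) * X * R

theorem derivative_succ_succ (hd : 1 ≤ d) (n : ℕ) :
    ((n : ℝ[X]) + C d) * derivative (zonalPoly d (n + 2)) = ((n : ℝ[X]) + 2) *
      (X * derivative (zonalPoly d (n + 1)) + ((n : ℝ[X]) + C d) * zonalPoly d (n + 1)) := by
  have hR := congrArg derivative (recurrence hd n)
  simp only [derivative_mul, derivative_sub, derivative_add, derivative_C, derivative_X,
    derivative_natCast, derivative_one, derivative_ofNat] at hR
  linear_combination hR - (derivative_relations hd n).1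

/-- Differentiating the second relation of `derivative_relations` and eliminating the lower degree
by the first gives the eigenvalue equation of the zonal Laplacian. -/
theorem gegenbauer_ode (hd : 1 ≤ d) (n : ℕ) :
    (1 - X ^ 2) * derivative (derivative (zonalPoly d n)) - C d * X * derivative (zonalPoly d n) =
      (-((n : ℝ) * (n + d - 1))) • zonalPoly d n := by
  rw [smul_eq_C_mul]
  simp only [map_neg, map_mul, map_sub, map_add, map_natCast, map_one]
  cases n with
  | zero => simp [zonalPoly]
  | succ n =>
    obtain ⟨ha, hc⟩ := derivative_relations hd n
    have hc' := congrArg derivative hc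
    simp only [derivative_mul, derivative_sub, derivative_add, derivative_X,
      derivative_natCast, derivative_one, derivative_X_pow] at hc'
    simp only [map_ofNat, Nat.cast_ofNat, Nat.add_one_sub_one, pow_one] at hc'
    push_cast
    linear_combination hc' + ha

theorem X_mul_succ (hd : 1 ≤ d) (n : ℕ) :
    X * zonalPoly d (n + 1) = (((n : ℝ) + d) / (2 * n + 1 + d)) • zonalPoly d (n + 2) +
      (((n : ℝ) + 1) / (2 * n + 1 + d)) • zonalPoly d n := by
  have h0 : (2 * (n : ℝ) + 1 + d) ≠ 0 := by positivity
  have h : C (2 * (n : ℝ) + 1 + d) ≠ 0 := C_ne_zero.2 h0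
  refine mul_left_cancel₀ h ?_
  rw [mul_add, smul_eq_C_mul, smul_eq_C_mul, ← mul_assoc (C _) (C _), ← mul_assoc (C _) (C _),
    ← C_mul, ← C_mul, mul_div_cancel₀ _ h0, mul_div_cancel₀ _ h0]
  simp only [map_mul, map_add, map_natCast, map_one, map_ofNat]
  linear_combination -recurrence hd n

theorem one_sub_sq_mul_derivative_succ (hd : 1 ≤ d) (n : ℕ) :
    (1 - X ^ 2) * derivative (zonalPoly d (n + 1)) =
      (((n : ℝ) + 1) * (n + d) / (2 * n + 1 + d)) • (zonalPoly d n - zonalPoly d (n + 2)) := by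
  have h0 : (2 * (n : ℝ) + 1 + d) ≠ 0 := by positivity
  rw [(derivative_relations hd n).2, X_mul_succ hd n]
  have e2 : ((n : ℝ[X]) + 1) = C ((n : ℝ) + 1) := by simp
  rw [e2, ← smul_eq_C_mul]
  match_scalars <;> field_simp
  ring

/-! ### The reproducing identity for an abstract pairing with integration by parts. -/

section Bilinear

variable {c : ℝ} (B : ℝ[X] →ₗ[ℝ] ℝ[X] →ₗ[ℝ] ℝ)
  (hone : B 1 1 = 1)
  (hleft : ∀ p q, d * B (X * p) q =
    B ((1 - X ^ 2) * derivative p) q + c * B p (derivative q) - B (X * p) (X * derivative q))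
  (hright : ∀ p q, d * B p (X * q) =
    B p ((1 - X ^ 2) * derivative q) + c * B (derivative p) q - B (X * derivative p) (X * q))

include hleft hright in
-- Self-adjointness: in `h1 - h2` the terms in both derivatives cancel, so the pairing is multiplied
-- by the difference of two eigenvalues, which factors as `(n - m) * (n + m + d - 1)` up to sign.
theorem bilinear_eq_zero (hd : 1 ≤ d) {n m : ℕ} (hnm : n ≠ m) :
    B (zonalPoly d n) (zonalPoly d m) = 0 := by
  have h1 := hleft (derivative (zonalPoly d n)) (zonalPoly d m)
  have h2 := hright (zonalPoly d n) (derivative (zonalPoly d m))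
  have o1 := congrArg (fun p => B p (zonalPoly d m)) (gegenbauer_ode hd n)
  have o2 := congrArg (fun p => B (zonalPoly d n) p) (gegenbauer_ode hd m)
  simp only [← smul_eq_C_mul, smul_mul_assoc, map_sub, map_smul, LinearMap.sub_apply,
    LinearMap.smul_apply, smul_eq_mul] at o1 o2
  have key : ((n : ℝ) - m) * (n + m + d - 1) * B (zonalPoly d n) (zonalPoly d m) = 0 := by
    linear_combination h1 - h2 + o1 - o2
  have hnm' : (n : ℝ) - m ≠ 0 := sub_ne_zero.2 (by exact_mod_cast hnm)
  have : (n : ℝ) + m + d - 1 ≠ 0 := by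
    have h : 0 < n + m := by omega
    have : (0 : ℝ) < n + m := by exact_mod_cast h
    linarith
  simpa [hnm', this] using key

include hleft hright in
-- Integration by parts is applied to degree `n + 1` and to an antiderivative `q` of a multiple of
-- it. Everything expands in degrees `n` and `n + 2`, and orthogonality removes the mixed terms. The
-- number `τ` stands for `(n + 1) / (n + d - 1)`, which is `1 / 0` when `n = 0` and `d = 1`; hence
-- it enters through `hτ` only.
theorem bilinear_recurrence (hd : 1 ≤ d) (n : ℕ) (τ : ℝ)
    (hτ : τ • derivative (zonalPoly d n) =
      X * derivative (zonalPoly d (n + 1)) - ((n : ℝ) + 1) • zonalPoly d (n + 1)) :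
    ((n : ℝ) + d) ^ 2 * (2 * n + d + 3) / (n + 2) * B (zonalPoly d (n + 2)) (zonalPoly d (n + 2)) =
      (2 * n + 1 + d) ^ 2 * c * B (zonalPoly d (n + 1)) (zonalPoly d (n + 1)) +
        (n + 1) * (-(n * τ) - (n + 1)) * B (zonalPoly d n) (zonalPoly d n) := by
  have h0 : (2 * (n : ℝ) + 1 + d) ≠ 0 := by positivity
  have h2 : ((n : ℝ) + 2) ≠ 0 := by positivity
  set q := (((n : ℝ) + d) / (n + 2)) • zonalPoly d (n + 2) - τ • zonalPoly d n with hq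
  have hq' : derivative q = (2 * (n : ℝ) + 1 + d) • zonalPoly d (n + 1) := by
    rw [hq, derivative_sub, derivative_smul, derivative_smul, hτ]
    have h2C : C ((n : ℝ) + 2) ≠ 0 := C_ne_zero.2 h2
    refine mul_left_cancel₀ h2C ?_
    have := derivative_succ_succ hd n
    rw [mul_sub, smul_eq_C_mul, ← mul_assoc, ← C_mul, mul_div_cancel₀ _ h2]
    simp only [smul_eq_C_mul, map_mul, map_add, map_natCast, map_one, map_ofNat]
    linear_combination this
  have h := hleft (zonalPoly d (n + 1)) q
  have o1 := bilinear_eq_zero B hleft hright hd (show n ≠ n + 2 by omega)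
  have o2 := bilinear_eq_zero B hleft hright hd (show n + 2 ≠ n by omega)
  rw [hq', one_sub_sq_mul_derivative_succ hd n, mul_smul_comm, X_mul_succ hd n, hq] at h
  simp only [map_sub, map_add, map_smul, LinearMap.sub_apply, LinearMap.add_apply,
    LinearMap.smul_apply, smul_eq_mul, o1, o2] at h
  field_simp at h ⊢
  linear_combination h

include hone hleft hright in
theorem bilinear_self (hd : 1 ≤ d) (n : ℕ) :
    B (zonalPoly d n) (zonalPoly d n) = zonalNormSq d n * (zonalPoly d n).eval c := by
  have key : ∀ n, B (zonalPoly d n) (zonalPoly d n) = zonalNormSq d n * (zonalPoly d n).eval c ∧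
      B (zonalPoly d (n + 1)) (zonalPoly d (n + 1)) =
        zonalNormSq d (n + 1) * (zonalPoly d (n + 1)).eval c := by
    intro n
    induction n with
    | zero =>
      refine ⟨by simp [zonalPoly, zonalNormSq, hone], ?_⟩
      have h := hleft 1 X
      have : d + 1 ≠ 0 := by positivity
      simp [hone] at h
      simp [zonalPoly, zonalNormSq]
      field_simp
      linear_combination h
    | succ n ih =>
      refine ⟨ih.2, ?_⟩
      obtain ⟨i0, i1⟩ := ih
      have hnd : (n : ℝ) + d ≠ 0 := by positivity
      have hnd3 : 2 * (n : ℝ) + d + 3 ≠ 0 := by positivity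
      have hev := congrArg (eval c) (recurrence hd n)
      simp only [eval_mul, eval_add, eval_sub, eval_C, eval_X, eval_natCast, eval_one,
        eval_ofNat] at hev
      -- For `n = 0` both sides of the first equation vanish and any `τ` would do. The second
      -- equation extracts a common factor `zonalNormSq d (n + 1)`, after which the recurrence at
      -- `c` finishes.
      obtain ⟨τ, hτ, hK⟩ : ∃ τ : ℝ, τ • derivative (zonalPoly d n) =
          X * derivative (zonalPoly d (n + 1)) - ((n : ℝ) + 1) • zonalPoly d (n + 1) ∧
          (n * τ + (n + 1)) * zonalNormSq d n = (2 * n + 1 + d) * zonalNormSq d (n + 1) := by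
        cases n with
        | zero =>
          refine ⟨0, by simp [zonalPoly], ?_⟩
          have : d + 1 ≠ 0 := by positivity
          simp [zonalNormSq]
          field_simp
          ring
        | succ k =>
          have hkd : (k : ℝ) + d ≠ 0 := by positivity
          refine ⟨(k + 2) / (k + d), ?_, ?_⟩
          · have h0 : C ((k : ℝ) + d) ≠ 0 := C_ne_zero.2 hkd
            refine mul_left_cancel₀ h0 ?_
            rw [smul_eq_C_mul, ← mul_assoc, ← C_mul, mul_div_cancel₀ _ hkd]
            have := (derivative_relations hd (k + 1)).1
            simp only [smul_eq_C_mul, map_add, map_natCast, map_one, map_ofNat]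
            push_cast at this ⊢
            linear_combination this
          · have : 2 * (k : ℝ) + d + 3 ≠ 0 := by positivity
            simp only [zonalNormSq]
            push_cast
            field_simp
            ring
      have h := bilinear_recurrence B hleft hright hd n τ hτ
      rw [i0, i1] at h
      have hn2 : (n : ℝ) + 2 ≠ 0 := by positivity
      have hcoef : ((n : ℝ) + d) ^ 2 * (2 * n + d + 3) / (n + 2) ≠ 0 := by positivity
      refine mul_left_cancel₀ hcoef (h.trans ?_)
      rw [show zonalNormSq d (n + 1 + 1) = (2 * (n : ℝ) + d + 1) * ((n : ℝ) + 2) /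
        (((n : ℝ) + d) * (2 * (n : ℝ) + d + 3)) * zonalNormSq d (n + 1) from rfl]
      field_simp
      linear_combination (-(n + 1) * eval c (zonalPoly d n)) * hK -
        ((2 * n + 1 + d) * zonalNormSq d (n + 1)) * hev
  exact (key n).1

end Bilinear

/-! ### Passage to the Chebyshev and Gegenbauer normalizations. -/

theorem chebyshev (n : ℕ) : zonalPoly 1 n = Chebyshev.T ℝ n := by
  induction n using Nat.twoStepInduction with
  | zero => simp [zonalPoly]
  | one => simp [zonalPoly]
  | more n h0 h1 =>
    have : (n : ℝ) + 1 ≠ 0 := by positivity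
    have e : (2 * (n : ℝ) + 1 + 1) / (n + 1) = 2 := by field_simp; ring
    rw [zonalPoly, h0, h1, e, div_self this]
    have := Chebyshev.T_add_two ℝ n
    push_cast
    rw [this]
    simp [map_ofNat C 2]

theorem normSq_one (n : ℕ) : zonalNormSq 1 (n + 1) = 1 / 2 := by
  induction n with
  | zero => norm_num [zonalNormSq]
  | succ n ih =>
    have : (n : ℝ) + 1 ≠ 0 := by positivity
    rw [zonalNormSq, ih]
    field_simp
    ring

/-- The reproducing constant of a multiple `C₀ P` is `C₀` times that of `P`, so the second equation
supplies the constant for `gegenbauerRec`. -/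
theorem gegenbauerRec_eq {lam : ℝ} (h : 0 < lam) (n : ℕ) :
    ∃ C₀ : ℝ, gegenbauerRec lam n = C C₀ * zonalPoly (2 * lam + 1) n ∧
      C₀ * zonalNormSq (2 * lam + 1) n = lam / (n + lam) := by
  -- The ratio of consecutive values at `1` is `(n + 2 * lam) / (n + 1)`; carrying two degrees at
  -- once serves the two-step recurrence.
  have key : ∀ n : ℕ, ∃ C₀ : ℝ, (gegenbauerRec lam n = C C₀ * zonalPoly (2 * lam + 1) n ∧
      C₀ * zonalNormSq (2 * lam + 1) n = lam / (n + lam)) ∧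
      (gegenbauerRec lam (n + 1) = C (C₀ * (n + 2 * lam) / (n + 1)) *
        zonalPoly (2 * lam + 1) (n + 1) ∧
      C₀ * (n + 2 * lam) / (n + 1) * zonalNormSq (2 * lam + 1) (n + 1) =
        lam / (n + 1 + lam)) := by
    intro n
    induction n with
    | zero =>
      refine ⟨1, ⟨by simp [gegenbauerRec, zonalPoly], by simp [zonalNormSq, h.ne']⟩,
        by simp [gegenbauerRec, zonalPoly], ?_⟩
      simp [zonalNormSq]
      field_simp
      ring
    | succ n ih =>
      obtain ⟨C₀, ⟨e0, k0⟩, e1, k1⟩ := ih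
      have hn : (n : ℝ) + (2 * lam + 1) ≠ 0 := by positivity
      have hn' : (n : ℝ) + 1 + 2 * lam ≠ 0 := by positivity
      refine ⟨C₀ * (n + 2 * lam) / (n + 1), ⟨e1, by push_cast; exact k1⟩, ?_, ?_⟩
      · rw [gegenbauerRec, e0, e1, zonalPoly]
        have h1 : 2 * ((n : ℝ) + 1 + lam) / (n + 2) * (C₀ * (n + 2 * lam) / (n + 1)) =
            C₀ * (n + 2 * lam) / (n + 1) * (n + 1 + 2 * lam) / (n + 2) *
              ((2 * n + 1 + (2 * lam + 1)) / (n + (2 * lam + 1))) := by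
          field_simp
          ring
        have h2 : ((n : ℝ) + 2 * lam) / (n + 2) * C₀ =
            C₀ * (n + 2 * lam) / (n + 1) * (n + 1 + 2 * lam) / (n + 2) *
              ((n + 1) / (n + (2 * lam + 1))) := by
          field_simp
          ring
        have h1' := congrArg C h1
        have h2' := congrArg C h2
        rw [C_mul, C_mul] at h1' h2'
        have e : C₀ * (n + 2 * lam) / (n + 1) * ((n + 1 : ℕ) + 2 * lam) / ((n + 1 : ℕ) + 1) =
            C₀ * (n + 2 * lam) / (n + 1) * (n + 1 + 2 * lam) / (n + 2) := by
          push_cast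
          ring
        rw [e]
        linear_combination (X * zonalPoly (2 * lam + 1) (n + 1)) * h1' -
          zonalPoly (2 * lam + 1) n * h2'
      · rw [zonalNormSq]
        have h3 : 2 * (n : ℝ) + (2 * lam + 1) + 3 ≠ 0 := by positivity
        have h4 : (n : ℝ) + 1 + lam ≠ 0 := by positivity
        have h5 : (n : ℝ) + 1 + 1 + lam ≠ 0 := by positivity
        push_cast
        calc _ = (C₀ * (n + 2 * lam) / (n + 1) * zonalNormSq (2 * lam + 1) (n + 1)) *
              ((n + 1 + lam) / (n + 1 + 1 + lam)) := by
              field_simp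
              ring
          _ = _ := by rw [k1]; field_simp
  obtain ⟨C₀, h, -⟩ := key n
  exact ⟨C₀, h⟩

end zonalPoly

/-! ### Gaussian integration by parts and polar coordinates. -/

section GaussianMoments

open Real Set Measure Module

variable {E : Type*} [NormedAddCommGroup E] [InnerProductSpace ℝ E]

theorem hasLineDerivAt_inner_pow (x y v : E) (j k : ℕ) :
    HasLineDerivAt ℝ (fun v : E => inner ℝ v x ^ j * inner ℝ v y ^ k)
      (j * inner ℝ v x ^ (j - 1) * inner ℝ x x * inner ℝ v y ^ k +
        inner ℝ v x ^ j * (k * inner ℝ v y ^ (k - 1) * inner ℝ x y)) v x := by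
  have h : ∀ z : E, HasDerivAt (fun t : ℝ => inner ℝ (v + t • x) z) (inner ℝ x z) 0 := by
    intro z
    simp only [inner_add_left, real_inner_smul_left]
    simpa using ((hasDerivAt_id (0 : ℝ)).mul_const (inner ℝ x z)).const_add (inner ℝ v z)
  have hm := ((h x).fun_pow j).fun_mul ((h y).fun_pow k)
  simpa only [HasLineDerivAt, zero_smul, add_zero] using hm

theorem hasLineDerivAt_exp_neg_sq (x v : E) :
    HasLineDerivAt ℝ (fun v : E => exp (-(1 / 2) * ‖v‖ ^ 2))
      (-inner ℝ v x * exp (-(1 / 2) * ‖v‖ ^ 2)) v x := by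
  have h := (((hasDerivAt_id (0 : ℝ)).smul_const x).const_add v).norm_sq.const_mul (-(1 / 2 : ℝ))
  have h' := h.exp
  simp only [id, zero_smul, add_zero, one_smul] at h'
  refine h'.congr_deriv ?_
  ring

variable [FiniteDimensional ℝ E] [MeasurableSpace E] [BorelSpace E]

theorem integrable_norm_pow_mul_exp_neg_sq [Nontrivial E] (m : ℕ) :
    Integrable fun v : E => ‖v‖ ^ m * exp (-(1 / 2) * ‖v‖ ^ 2) := by
  rw [integrable_fun_norm_addHaar (volume : Measure E)
    (f := fun r => r ^ m * exp (-(1 / 2) * r ^ 2))]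
  have h := integrableOn_rpow_mul_exp_neg_mul_sq (b := 1 / 2) (by norm_num)
    (s := ((finrank ℝ E - 1 + m : ℕ) : ℝ)) (by
      have : (0 : ℝ) ≤ ((finrank ℝ E - 1 + m : ℕ) : ℝ) := Nat.cast_nonneg _
      linarith)
  refine h.congr_fun (fun r _ => ?_) measurableSet_Ioi
  simp only [rpow_natCast, smul_eq_mul]
  ring

theorem integrable_inner_pow_mul_exp_neg_sq [Nontrivial E] (x y : E) (j k : ℕ) :
    Integrable fun v : E =>
      inner ℝ v x ^ j * inner ℝ v y ^ k * exp (-(1 / 2) * ‖v‖ ^ 2) := by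
  refine ((integrable_norm_pow_mul_exp_neg_sq (E := E) (j + k)).const_mul
    (‖x‖ ^ j * ‖y‖ ^ k)).mono' (by fun_prop) (.of_forall fun v => ?_)
  rw [norm_mul, norm_mul, norm_pow, norm_pow, norm_of_nonneg (exp_pos _).le]
  calc _ ≤ (‖v‖ * ‖x‖) ^ j * (‖v‖ * ‖y‖) ^ k * exp (-(1 / 2) * ‖v‖ ^ 2) := by
        gcongr <;> exact norm_inner_le_norm _ _
    _ = _ := by ring

/-- Stein's identity: the derivative of the Gaussian weight along `x` is `-⟨v, x⟩` times the weight.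
Truncated exponents are harmless, since their coefficients `j`, `k` are then zero. -/
theorem integral_inner_pow_succ_mul_exp_neg_sq [Nontrivial E] {x : E} (hx : ‖x‖ = 1) (y : E)
    (j k : ℕ) :
    ∫ v : E, inner ℝ v x ^ (j + 1) * inner ℝ v y ^ k * exp (-(1 / 2) * ‖v‖ ^ 2) =
      j * (∫ v : E, inner ℝ v x ^ (j - 1) * inner ℝ v y ^ k * exp (-(1 / 2) * ‖v‖ ^ 2)) +
      k * inner ℝ x y *
        ∫ v : E, inner ℝ v x ^ j * inner ℝ v y ^ (k - 1) * exp (-(1 / 2) * ‖v‖ ^ 2) := by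
  have hxx : inner ℝ x x = (1 : ℝ) := by rw [real_inner_self_eq_norm_sq, hx]; norm_num
  have i1 := (integrable_inner_pow_mul_exp_neg_sq x y (j - 1) k).const_mul (j : ℝ)
  have i2 := (integrable_inner_pow_mul_exp_neg_sq x y j (k - 1)).const_mul (k * inner ℝ x y : ℝ)
  have e1 : ∀ v : E, (j * inner ℝ v x ^ (j - 1) * inner ℝ x x * inner ℝ v y ^ k +
        inner ℝ v x ^ j * (k * inner ℝ v y ^ (k - 1) * inner ℝ x y)) *
          exp (-(1 / 2) * ‖v‖ ^ 2) =
      j * (inner ℝ v x ^ (j - 1) * inner ℝ v y ^ k * exp (-(1 / 2) * ‖v‖ ^ 2)) +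
      k * inner ℝ x y *
        (inner ℝ v x ^ j * inner ℝ v y ^ (k - 1) * exp (-(1 / 2) * ‖v‖ ^ 2)) := by
    intro v
    rw [hxx]
    ring
  have e2 : ∀ v : E, (inner ℝ v x ^ j * inner ℝ v y ^ k) *
      (-inner ℝ v x * exp (-(1 / 2) * ‖v‖ ^ 2)) =
      -(inner ℝ v x ^ (j + 1) * inner ℝ v y ^ k * exp (-(1 / 2) * ‖v‖ ^ 2)) := by
    intro v
    ring
  have h := integral_bilinear_hasLineDerivAt_right_eq_neg_left_of_integrable (μ := volume)
    (f := fun v : E => inner ℝ v x ^ j * inner ℝ v y ^ k)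
    (g := fun v : E => exp (-(1 / 2) * ‖v‖ ^ 2)) (B := ContinuousLinearMap.mul ℝ ℝ) (v := x)
    (f' := fun v => j * inner ℝ v x ^ (j - 1) * inner ℝ x x * inner ℝ v y ^ k +
        inner ℝ v x ^ j * (k * inner ℝ v y ^ (k - 1) * inner ℝ x y))
    (g' := fun v => -inner ℝ v x * exp (-(1 / 2) * ‖v‖ ^ 2))
    (by
      simp only [ContinuousLinearMap.mul_apply', e1]
      exact i1.add i2)
    (by
      simp only [ContinuousLinearMap.mul_apply', e2]
      exact (integrable_inner_pow_mul_exp_neg_sq x y (j + 1) k).neg)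
    (by simpa only [ContinuousLinearMap.mul_apply'] using
      integrable_inner_pow_mul_exp_neg_sq x y j k)
    (fun v _ => hasLineDerivAt_inner_pow x y v j k) (fun v _ => hasLineDerivAt_exp_neg_sq x v)
  simp only [ContinuousLinearMap.mul_apply', e1, e2] at h
  rw [integral_neg, neg_inj, integral_add i1 i2, integral_const_mul, integral_const_mul] at h
  exact h

/-- The radial Gaussian moments. -/
def radialMoment (q : ℕ) : ℝ := ∫ r in Ioi (0 : ℝ), r ^ q * exp (-(1 / 2) * r ^ 2)

theorem radialMoment_eq (q : ℕ) : radialMoment q =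
    (1 / 2 : ℝ) ^ (-((q : ℝ) + 1) / 2) * (1 / 2) * Gamma (((q : ℝ) + 1) / 2) := by
  rw [radialMoment, ← integral_rpow_mul_exp_neg_mul_rpow (by norm_num)
    (show (-1 : ℝ) < q from lt_of_lt_of_le (by norm_num) (Nat.cast_nonneg q)) (by norm_num)]
  simp

theorem radialMoment_pos (q : ℕ) : 0 < radialMoment q := by
  rw [radialMoment_eq]
  have := Gamma_pos_of_pos (show (0 : ℝ) < ((q : ℝ) + 1) / 2 by positivity)
  positivity

theorem radialMoment_add_two (q : ℕ) : radialMoment (q + 2) = (q + 1) * radialMoment q := by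
  rw [radialMoment_eq, radialMoment_eq]
  have h1 : (((q + 2 : ℕ) : ℝ) + 1) / 2 = ((q : ℝ) + 1) / 2 + 1 := by push_cast; ring
  have h2 : -(((q + 2 : ℕ) : ℝ) + 1) / 2 = -((q : ℝ) + 1) / 2 - 1 := by push_cast; ring
  rw [h1, h2, Gamma_add_one (by positivity), rpow_sub_one (by norm_num)]
  ring

/-- Polar coordinates split the integral of a homogeneous function, so Gaussian identities transfer
to the sphere. -/
theorem integral_homogeneous_mul_exp_neg_sq [Nontrivial E] (h : E → ℝ) (m : ℕ)
    (hh : ∀ (r : ℝ) (v : E), 0 < r → h (r • v) = r ^ m * h v) :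
    ∫ v : E, h v * exp (-(1 / 2) * ‖v‖ ^ 2) =
      (∫ o, h o ∂(volume : Measure E).toSphere) * radialMoment (finrank ℝ E - 1 + m) := by
  calc ∫ v : E, h v * exp (-(1 / 2) * ‖v‖ ^ 2)
      = ∫ v : ({(0)}ᶜ : Set E), h v * exp (-(1 / 2) * ‖v.1‖ ^ 2) 
          ∂((volume : Measure E).comap Subtype.val) := by
        rw [integral_subtype_comap (measurableSet_singleton _).compl
          fun v : E => h v * exp (-(1 / 2) * ‖v‖ ^ 2), restrict_compl_singleton]
    _ = ∫ p : Metric.sphere (0 : E) 1 × Ioi (0 : ℝ),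
          h p.1 * (p.2.1 ^ m * exp (-(1 / 2) * p.2.1 ^ 2))
          ∂(volume : Measure E).toSphere.prod (.volumeIoiPow (finrank ℝ E - 1)) := by
        rw [← (volume : Measure E).measurePreserving_homeomorphUnitSphereProd.integral_comp
          (Homeomorph.measurableEmbedding _)]
        refine integral_congr_ae (.of_forall fun v => ?_)
        have hv : 0 < ‖v.1‖ := norm_pos_iff.2 v.2
        simp only [homeomorphUnitSphereProd_apply_snd_coe, homeomorphUnitSphereProd_apply_fst_coe]
        rw [← mul_assoc, mul_comm (h _) (_ ^ m), ← hh _ _ hv, smul_inv_smul₀ hv.ne']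
    _ = (∫ o, h o ∂(volume : Measure E).toSphere) *
          ∫ r : Ioi (0 : ℝ), (r : ℝ) ^ m * exp (-(1 / 2) * (r : ℝ) ^ 2)
            ∂(.volumeIoiPow (finrank ℝ E - 1)) :=
        integral_prod_mul (fun o : Metric.sphere (0 : E) 1 => h o)
          (fun r : Ioi (0 : ℝ) => (r : ℝ) ^ m * exp (-(1 / 2) * (r : ℝ) ^ 2))
    _ = _ := by
        congr 1
        simp only [volumeIoiPow, ENNReal.ofReal, radialMoment]
        rw [integral_withDensity_eq_integral_smul (by fun_prop),
          integral_subtype_comap measurableSet_Ioi fun r : ℝ =>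
            (r ^ (finrank ℝ E - 1)).toNNReal • (r ^ m * exp (-(1 / 2) * r ^ 2))]
        refine setIntegral_congr_fun measurableSet_Ioi fun r hr => ?_
        rw [NNReal.smul_def, coe_toNNReal _ (pow_nonneg (le_of_lt hr) _), smul_eq_mul]
        ring

end GaussianMoments

/-! ### The pairing of zonal functions on the sphere. -/

section Sphere

open Polynomial

variable {d : ℕ}

instance : IsProbabilityMeasure (sphereUniform d) := by
  have : ((volume : Measure (EuclideanSpace ℝ (Fin (d + 1)))).toSphere Set.univ) ≠ 0 := by
    rw [Ne, Measure.measure_univ_eq_zero]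
    exact (volume : Measure (EuclideanSpace ℝ (Fin (d + 1)))).toSphere_ne_zero
  constructor
  rw [sphereUniform, Measure.smul_apply, smul_eq_mul, ENNReal.inv_mul_cancel this (by finiteness)]

theorem sphereInner_comm (x y : UnitSphere d) : sphereInner x y = sphereInner y x :=
  real_inner_comm _ _

theorem sphereInner_self (x : UnitSphere d) : sphereInner x x = 1 := by
  simp [sphereInner]

theorem abs_sphereInner_le (x y : UnitSphere d) : |sphereInner x y| ≤ 1 := by
  simpa [sphereInner] using abs_real_inner_le_norm (x : EuclideanSpace ℝ (Fin (d + 1))) y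

@[fun_prop]
theorem continuous_sphereInner_left (x : UnitSphere d) : Continuous fun o => sphereInner o x := by
  unfold sphereInner
  fun_prop

theorem integrable_eval_mul_eval (x y : UnitSphere d) (p q : ℝ[X]) :
    Integrable (fun o => p.eval (sphereInner o x) * q.eval (sphereInner o y))
      (sphereUniform d) :=
  Continuous.integrable_of_hasCompactSupport (by fun_prop) (HasCompactSupport.of_compactSpace _)

/-- The pairing of two zonal functions with poles `x` and `y` in mean square. -/
def sphereForm (x y : UnitSphere d) : ℝ[X] →ₗ[ℝ] ℝ[X] →ₗ[ℝ] ℝ :=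
  LinearMap.mk₂ ℝ
    (fun p q => ∫ o, p.eval (sphereInner o x) * q.eval (sphereInner o y) ∂sphereUniform d)
    (fun p p' q => by
      simp only [eval_add, add_mul]
      exact integral_add (integrable_eval_mul_eval x y p q) (integrable_eval_mul_eval x y p' q))
    (fun a p q => by
      simp only [eval_smul, smul_eq_mul, mul_assoc]
      exact integral_const_mul _ _)
    (fun p q q' => by
      simp only [eval_add, mul_add]
      exact integral_add (integrable_eval_mul_eval x y p q) (integrable_eval_mul_eval x y p q'))
    (fun a p q => by
      simp only [eval_smul, smul_eq_mul, mul_left_comm _ a]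
      exact integral_const_mul _ _)

theorem sphereForm_apply (x y : UnitSphere d) (p q : ℝ[X]) : sphereForm x y p q =
    ∫ o, p.eval (sphereInner o x) * q.eval (sphereInner o y) ∂sphereUniform d := rfl

theorem sphereForm_swap (x y : UnitSphere d) (p q : ℝ[X]) :
    sphereForm x y p q = sphereForm y x q p := by
  simp only [sphereForm_apply, mul_comm]

theorem sphereForm_one (x y : UnitSphere d) : sphereForm x y 1 1 = 1 := by
  simp [sphereForm_apply]

theorem sphereForm_X_pow_succ (x y : UnitSphere d) (j k : ℕ) :
    ((d : ℝ) + j + k) * sphereForm x y (X ^ (j + 1)) (X ^ k) =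
      j * sphereForm x y (X ^ (j - 1)) (X ^ k) +
        k * sphereInner x y * sphereForm x y (X ^ j) (X ^ (k - 1)) := by
  have hom : ∀ (j k : ℕ), ∫ v : EuclideanSpace ℝ (Fin (d + 1)),
      inner ℝ v x.1 ^ j * inner ℝ v y.1 ^ k * Real.exp (-(1 / 2) * ‖v‖ ^ 2) =
      (∫ o, sphereInner o x ^ j * sphereInner o y ^ k
        ∂(volume : Measure (EuclideanSpace ℝ (Fin (d + 1)))).toSphere) *
        radialMoment (d + (j + k)) := by
    intro j k
    have := integral_homogeneous_mul_exp_neg_sq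
      (fun v : EuclideanSpace ℝ (Fin (d + 1)) => inner ℝ v x.1 ^ j * inner ℝ v y.1 ^ k) (j + k)
      (fun r v _ => by
        simp only [real_inner_smul_left]
        ring)
    simpa [sphereInner] using this
  have h := integral_inner_pow_succ_mul_exp_neg_sq (x := x.1) (by simp) y.1 j k
  rw [hom, hom, hom] at h
  simp only [sphereForm_apply, eval_pow, eval_X, sphereUniform, integral_smul_measure, smul_eq_mul]
  have key : ((d : ℝ) + j + k) * (∫ o, sphereInner o x ^ (j + 1) * sphereInner o y ^ k
        ∂(volume : Measure (EuclideanSpace ℝ (Fin (d + 1)))).toSphere) =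
      j * (∫ o, sphereInner o x ^ (j - 1) * sphereInner o y ^ k
        ∂(volume : Measure (EuclideanSpace ℝ (Fin (d + 1)))).toSphere) +
      k * sphereInner x y * (∫ o, sphereInner o x ^ j * sphereInner o y ^ (k - 1)
        ∂(volume : Measure (EuclideanSpace ℝ (Fin (d + 1)))).toSphere) := by
    change _ = _ * (_ * _) + _ * sphereInner x y * (_ * _) at h
    -- When `j + k > 0`, the left radial moment is two orders above those on the right, and
    -- `radialMoment_add_two` produces the factor `d + j + k`. When `j = k = 0` the right side is
    -- zero.
    rcases Nat.eq_zero_or_pos (j + k) with h0 | h0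
    · obtain ⟨rfl, rfl⟩ : j = 0 ∧ k = 0 := by omega
      simp [(radialMoment_pos _).ne'] at h
      simp [h]
    · obtain ⟨m, hm⟩ : ∃ m, j + k = m + 1 := ⟨j + k - 1, by omega⟩
      have w1 : radialMoment (d + (j + 1 + k)) = ((d : ℝ) + j + k) * radialMoment (d + m) := by
        rw [show d + (j + 1 + k) = d + m + 2 by omega, radialMoment_add_two]
        have : (j : ℝ) + k = m + 1 := by exact_mod_cast hm
        push_cast
        linear_combination -radialMoment (d + m) * this
      refine mul_right_cancel₀ (radialMoment_pos (d + m)).ne' ?_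
      rw [w1] at h
      -- If `j` or `k` is zero, truncated subtraction gives one term the wrong degree, but its
      -- coefficient vanishes.
      rcases Nat.eq_zero_or_pos j with hj | hj <;> rcases Nat.eq_zero_or_pos k with hk | hk
      · omega
      · rw [show j + (k - 1) = m by omega] at h
        subst hj
        simp only [Nat.cast_zero, zero_mul] at h ⊢
        linear_combination h
      · rw [show j - 1 + k = m by omega] at h
        subst hk
        simp only [Nat.cast_zero, zero_mul] at h ⊢
        linear_combination h
      · rw [show j - 1 + k = m by omega, show j + (k - 1) = m by omega] at h
        linear_combination h
  linear_combination (((volume : Measure (EuclideanSpace ℝ (Fin (d + 1)))).toSphere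
    Set.univ)⁻¹).toReal * key

/-- This is the divergence theorem for the tangential field `x - (o·x) o`, whose divergence is `-d
(o·x)`. By bilinearity it reduces to the moment identity for monomials. -/
theorem sphereForm_X_mul (x y : UnitSphere d) (p q : ℝ[X]) :
    d * sphereForm x y (X * p) q = sphereForm x y ((1 - X ^ 2) * derivative p) q +
      sphereInner x y * sphereForm x y p (derivative q) -
        sphereForm x y (X * p) (X * derivative q) := by
  induction p using Polynomial.induction_on' with
  | add p p' h h' =>
    simp only [mul_add, map_add, LinearMap.add_apply, h, h']
    ring
  | monomial j a =>
    induction q using Polynomial.induction_on' with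
    | add q q' h h' =>
      simp only [mul_add, map_add, h, h']
      ring
    | monomial k b =>
      have h := sphereForm_X_pow_succ x y j k
      have eX : X * monomial j a = a • (X ^ (j + 1) : ℝ[X]) := by
        rw [← C_mul_X_pow_eq_monomial, smul_eq_C_mul]
        ring
      have eX' : X * (monomial (k - 1) (b * k) : ℝ[X]) = (b * k) • (X ^ k : ℝ[X]) := by
        rcases k with - | k
        · simp
        · rw [← C_mul_X_pow_eq_monomial, smul_eq_C_mul, Nat.add_sub_cancel]
          ring
      have eL : (1 - X ^ 2) * (monomial (j - 1) (a * j) : ℝ[X]) =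
          (a * j) • (X ^ (j - 1) - X ^ (j + 1) : ℝ[X]) := by
        rcases j with - | j
        · simp
        · rw [← C_mul_X_pow_eq_monomial, smul_eq_C_mul, Nat.add_sub_cancel]
          ring
      rw [derivative_monomial, derivative_monomial, eX, eX', eL]
      simp only [← C_mul_X_pow_eq_monomial, ← smul_eq_C_mul, map_smul, LinearMap.smul_apply,
        smul_eq_mul, map_sub, LinearMap.sub_apply]
      linear_combination a * b * h

theorem integral_zonalPoly_mul_zonalPoly (hd : 1 ≤ d) (x y : UnitSphere d) (n : ℕ) :
    ∫ o, (zonalPoly d n).eval (sphereInner o x) * (zonalPoly d n).eval (sphereInner o y)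
      ∂sphereUniform d = zonalNormSq d n * (zonalPoly d n).eval (sphereInner x y) := by
  refine zonalPoly.bilinear_self (sphereForm x y) (sphereForm_one x y) (sphereForm_X_mul x y)
    (fun p q => ?_) (by exact_mod_cast hd) n
  have := sphereForm_X_mul y x q p
  simpa only [sphereForm_swap y x, sphereInner_comm y x] using this

theorem integral_chebyshev_mul_chebyshev (x y : UnitSphere 1) (n : ℕ) :
    ∫ o, (Chebyshev.T ℝ n).eval (sphereInner o x) * (Chebyshev.T ℝ n).eval (sphereInner o y)
      ∂sphereUniform 1 =
        (if n = 0 then 1 else 2)⁻¹ * (Chebyshev.T ℝ n).eval (sphereInner x y) := by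
  have h := integral_zonalPoly_mul_zonalPoly le_rfl x y n
  simp only [Nat.cast_one, zonalPoly.chebyshev] at h
  rw [h]
  rcases n with - | n
  · simp [zonalNormSq]
  · simp [zonalPoly.normSq_one]

theorem integral_gegenbauer_mul_gegenbauer (hd : 2 ≤ d) (x y : UnitSphere d) (n : ℕ) :
    ∫ o, (gegenbauer (((d : ℝ) - 1) / 2) n).eval (sphereInner o x) *
      (gegenbauer (((d : ℝ) - 1) / 2) n).eval (sphereInner o y) ∂sphereUniform d =
        ((d : ℝ) - 1) / (2 * n + d - 1) *
          (gegenbauer (((d : ℝ) - 1) / 2) n).eval (sphereInner x y) := by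
  have hd' : (2 : ℝ) ≤ d := by exact_mod_cast hd
  have hlam : 0 < ((d : ℝ) - 1) / 2 := by linarith
  obtain ⟨C₀, h1, h2⟩ := zonalPoly.gegenbauerRec_eq hlam n
  have e : 2 * (((d : ℝ) - 1) / 2) + 1 = d := by ring
  rw [e] at h1 h2
  have h := integral_zonalPoly_mul_zonalPoly (by omega) x y n
  simp only [gegenbauer, if_neg hlam.ne', h1, eval_mul, eval_C]
  simp only [mul_mul_mul_comm C₀]
  rw [integral_const_mul, h]
  have h3 : ((d : ℝ) - 1) / (2 * n + d - 1) = C₀ * zonalNormSq d n := by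
    rw [h2]
    rw [show (n : ℝ) + ((d : ℝ) - 1) / 2 = (2 * n + d - 1) / 2 by ring,
      div_div_div_cancel_right₀ two_ne_zero]
  rw [h3]
  ring

theorem exists_sphereInner_eq (hd : 1 ≤ d) {r : ℝ} (hr : |r| ≤ 1) :
    ∃ x y : UnitSphere d, sphereInner x y = r := by
  obtain ⟨d, rfl⟩ := Nat.exists_eq_add_of_le' hd
  have hr2 : 0 ≤ 1 - r ^ 2 := by
    rw [sub_nonneg, sq_le_one_iff_abs_le_one]
    exact hr
  refine ⟨⟨EuclideanSpace.single 0 1, by simp⟩, ⟨r • EuclideanSpace.single 0 1 +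
    Real.sqrt (1 - r ^ 2) • EuclideanSpace.single 1 1, ?_⟩, ?_⟩
  · rw [mem_sphere_zero_iff_norm, ← sq_eq_sq₀ (norm_nonneg _) zero_le_one, norm_add_sq_real]
    simp [norm_smul, real_inner_smul_left, real_inner_smul_right, Real.sq_sqrt hr2,
      EuclideanSpace.inner_single_left]
  · simp [sphereInner, inner_add_right, EuclideanSpace.inner_single_left]

/-- Every `r` in `[-1, 1]` is some `x·y`; the reproducing identity with `|uv| ≤ (u² + v²) / 2` then
bounds the value there by the value at `x·x = y·y = 1`. -/
theorem abs_eval_le_eval_one (hd : 1 ≤ d) {p : ℝ[X]} {γ : ℝ} (hγ : 0 < γ)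
    (hp : ∀ x y : UnitSphere d, ∫ o, p.eval (sphereInner o x) * p.eval (sphereInner o y)
      ∂sphereUniform d = γ * p.eval (sphereInner x y)) {r : ℝ} (hr : |r| ≤ 1) :
    |p.eval r| ≤ p.eval 1 := by
  obtain ⟨x, y, rfl⟩ := exists_sphereInner_eq hd hr
  have hx := hp x x
  have hy := hp y y
  rw [sphereInner_self] at hx hy
  refine le_of_mul_le_mul_left ?_ hγ
  calc γ * |p.eval (sphereInner x y)|
      = |∫ o, p.eval (sphereInner o x) * p.eval (sphereInner o y) ∂sphereUniform d| := by
        rw [hp, abs_mul, abs_of_pos hγ]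
    _ ≤ ∫ o, |p.eval (sphereInner o x) * p.eval (sphereInner o y)| ∂sphereUniform d :=
        abs_integral_le_integral_abs
    _ ≤ ∫ o, (1 / 2 * (p.eval (sphereInner o x) * p.eval (sphereInner o x)) +
          1 / 2 * (p.eval (sphereInner o y) * p.eval (sphereInner o y))) ∂sphereUniform d := by
        refine integral_mono (integrable_eval_mul_eval x y p p).abs
          (((integrable_eval_mul_eval x x p p).const_mul _).add
            ((integrable_eval_mul_eval y y p p).const_mul _)) fun o => ?_
        rw [abs_le]
        constructor
        · nlinarith [sq_nonneg (p.eval (sphereInner o x) + p.eval (sphereInner o y))]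
        · nlinarith [sq_nonneg (p.eval (sphereInner o x) - p.eval (sphereInner o y))]
    _ = γ * p.eval 1 := by
        rw [integral_add ((integrable_eval_mul_eval x x p p).const_mul _)
          ((integrable_eval_mul_eval y y p p).const_mul _), integral_const_mul,
          integral_const_mul, hx, hy]
        ring

end Sphere

/-! ### The wave without `ε`, on the product of the sphere and the degrees. -/

section Wave

open Polynomial

variable {d : ℕ}

/-- The value at `x` of the zonal function with pole `o`, degree `n`, and squared weight `v n`. -/
def zonalWave (v : ℕ → ℝ) (q : ℕ → ℝ[X]) (x : UnitSphere d) (p : UnitSphere d × ℕ) : ℝ :=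
  Real.sqrt (v p.2) * (q p.2).eval (sphereInner p.1 x)

theorem measurable_zonalWave (v : ℕ → ℝ) (q : ℕ → ℝ[X]) (x : UnitSphere d) :
    Measurable (zonalWave v q x) := by
  refine measurable_from_prod_countable_left fun n => ?_
  simp only [zonalWave]
  exact Continuous.measurable (by fun_prop)

variable {v b γ : ℕ → ℝ} {q : ℕ → ℝ[X]} {ρ : Measure ℕ} [IsProbabilityMeasure ρ]
  (hv : ∀ n, 0 ≤ v n)
  (hq : ∀ n (x y : UnitSphere d), ∫ o, (q n).eval (sphereInner o x) * (q n).eval (sphereInner o y)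
    ∂sphereUniform d = γ n * (q n).eval (sphereInner x y))
  (hvb : ∀ n, ρ.real {n} * (v n * γ n) = b n)
  (hsum : Summable fun n => b n * (q n).eval 1)

include hv hq in
theorem integral_zonalWave_mul_zonalWave_left (x y : UnitSphere d) (n : ℕ) :
    ∫ o, zonalWave v q x (o, n) * zonalWave v q y (o, n) ∂sphereUniform d =
      v n * γ n * (q n).eval (sphereInner x y) := by
  simp only [zonalWave]
  rw [mul_assoc, ← hq, ← integral_const_mul]
  congr 1 with o
  rw [mul_mul_mul_comm, Real.mul_self_sqrt (hv n)]

include hv hq hvb hsum in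
-- Integrating the square over the pole first leaves the series `∑ b n * (q n).eval 1`, so
-- Schoenberg summability is square integrability.
theorem memLp_zonalWave (x : UnitSphere d) :
    MemLp (zonalWave v q x) 2 ((sphereUniform d).prod ρ) := by
  have hm := measurable_zonalWave v q x
  rw [memLp_two_iff_integrable_sq hm.aestronglyMeasurable,
    integrable_prod_iff' (hm.pow_const 2).aestronglyMeasurable]
  constructor
  · refine .of_forall fun n => ?_
    simp only [zonalWave]
    exact Continuous.integrable_of_hasCompactSupport (by fun_prop)
      (HasCompactSupport.of_compactSpace _)
  · have h : ∀ n, ∫ o, ‖zonalWave v q x (o, n) ^ 2‖ ∂sphereUniform d =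
        v n * γ n * (q n).eval 1 := by
      intro n
      have h1 := integral_zonalWave_mul_zonalWave_left hv hq x x n
      rw [sphereInner_self] at h1
      rw [← h1]
      congr 1 with o
      rw [Real.norm_of_nonneg (sq_nonneg _), sq]
    have h0 : ∀ n, 0 ≤ v n * γ n * (q n).eval 1 := fun n => by
      rw [← h]
      exact integral_nonneg fun o => norm_nonneg _
    simp only [h]
    rw [← Measure.sum_smul_dirac ρ]
    refine integrable_sum_dirac (by finiteness) (hsum.congr fun n => ?_)
    rw [Real.norm_of_nonneg (h0 n), ← mul_assoc, ← hvb n, measureReal_def]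

include hv hq hvb hsum in
theorem integral_zonalWave_mul_zonalWave (x y : UnitSphere d) :
    ∫ p, zonalWave v q x p * zonalWave v q y p ∂(sphereUniform d).prod ρ =
      ∑' n, b n * (q n).eval (sphereInner x y) := by
  have hI : Integrable (fun p => zonalWave v q x p * zonalWave v q y p)
      ((sphereUniform d).prod ρ) :=
    (memLp_zonalWave hv hq hvb hsum x).integrable_mul (memLp_zonalWave hv hq hvb hsum y)
  rw [integral_prod_symm _ hI, integral_countable hI.integral_prod_right]
  congr 1 with n
  rw [integral_zonalWave_mul_zonalWave_left hv hq, smul_eq_mul, ← mul_assoc, hvb]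

end Wave

theorem cos_geodesicDist {d : ℕ} (x y : UnitSphere d) :
    Real.cos (geodesicDist x y) = sphereInner x y := by
  have h := abs_le.1 (abs_sphereInner_le x y)
  exact Real.cos_arccos h.1 h.2

theorem indepFun_prodMk_of_iIndep {Ω α β γ : Type*} [MeasurableSpace Ω] [MeasurableSpace α]
    [MeasurableSpace β] [MeasurableSpace γ] {μ : Measure Ω} {f : Ω → α} {g : Ω → β} {h : Ω → γ}
    (hf : Measurable f) (hg : Measurable g) (hh : Measurable h)
    (hindep : iIndep ![MeasurableSpace.comap f inferInstance,
      MeasurableSpace.comap g inferInstance, MeasurableSpace.comap h inferInstance] μ) :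
    IndepFun f (fun w => (g w, h w)) μ ∧ IndepFun g h μ := by
  constructor
  · have hle : ∀ i, ![MeasurableSpace.comap f inferInstance,
        MeasurableSpace.comap g inferInstance, MeasurableSpace.comap h inferInstance] i ≤
          ‹MeasurableSpace Ω› := by
      intro i
      fin_cases i
      exacts [hf.comap_le, hg.comap_le, hh.comap_le]
    have key := indep_iSup_of_disjoint hle hindep (S := {0}) (T := {1, 2}) (by simp)
    simp only [iSup_singleton, iSup_pair, Matrix.cons_val] at key
    rw [IndepFun_iff_Indep]
    convert key using 1
    exact MeasurableSpace.comap_prodMk g h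
  · rw [IndepFun_iff_Indep]
    exact hindep.indep (i := 1) (j := 2) (by decide)

/-! ### The random fields. -/

section Field

open Polynomial

variable {Ω : Type*} [MeasurableSpace Ω] {μ : Measure Ω} [IsProbabilityMeasure μ] {d : ℕ}
  {ε : Ω → ℝ} {ω : Ω → UnitSphere d} {κ : Ω → ℕ}

theorem isIsotropic_of_eq_zonalWave (hd : 1 ≤ d)
    (hε : Measurable ε) (hω : Measurable ω) (hκ : Measurable κ)
    (hε_sq : MemLp ε 2 μ) (hε_mean : ∫ w, ε w ∂μ = 0) (hε_var : variance ε μ = 1)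
    (hω_unif : μ.map ω = sphereUniform d)
    (hindep : iIndep ![MeasurableSpace.comap ε inferInstance,
      MeasurableSpace.comap ω inferInstance, MeasurableSpace.comap κ inferInstance] μ)
    {v b γ : ℕ → ℝ} {q : ℕ → ℝ[X]} (hb : ∀ n, 0 ≤ b n) (hv : ∀ n, 0 ≤ v n) (hγ : ∀ n, 0 < γ n)
    (hq : ∀ n (x y : UnitSphere d),
      ∫ o, (q n).eval (sphereInner o x) * (q n).eval (sphereInner o y) ∂sphereUniform d =
        γ n * (q n).eval (sphereInner x y))
    (hvb : ∀ n, μ.real {w | κ w = n} * (v n * γ n) = b n)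
    (hsum : Summable fun n => b n * (q n).eval 1)
    {Z : UnitSphere d → Ω → ℝ} (hZ : ∀ x w, Z x w = ε w * zonalWave v q x (ω w, κ w)) :
    (∀ θ : ℝ, Summable fun n => b n * (q n).eval (Real.cos θ)) ∧
      IsIsotropic μ Z ∧ (∀ x, ∫ w, Z x w ∂μ = 0) ∧
      IsIsotropicPart μ Z (fun θ => ∑' n, b n * (q n).eval (Real.cos θ)) := by
  obtain ⟨hi1, hi2⟩ := indepFun_prodMk_of_iIndep hε hω hκ hindep
  have hωκ : Measurable fun w => (ω w, κ w) := hω.prodMk hκ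
  have : IsProbabilityMeasure (μ.map κ) := Measure.isProbabilityMeasure_map hκ.aemeasurable
  have hlaw : μ.map (fun w => (ω w, κ w)) = (sphereUniform d).prod (μ.map κ) := by
    rw [hi2.map_prod_eq_prod_map_map hω.aemeasurable hκ.aemeasurable, hω_unif]
  have hvb' : ∀ n, (μ.map κ).real {n} * (v n * γ n) = b n := fun n => by
    rw [map_measureReal_apply hκ (measurableSet_singleton n)]
    exact hvb n
  have hbound : ∀ n (θ : ℝ), ‖b n * (q n).eval (Real.cos θ)‖ ≤ b n * (q n).eval 1 := fun n θ => by
    rw [norm_mul, Real.norm_of_nonneg (hb n)]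
    exact mul_le_mul_of_nonneg_left
      (abs_eval_le_eval_one hd (hγ n) (hq n) (Real.abs_cos_le_one θ)) (hb n)
  have hgm := measurable_zonalWave (d := d) v q
  have hgL : ∀ x, MemLp (fun w => zonalWave v q x (ω w, κ w)) 2 μ := fun x => by
    have h := memLp_zonalWave hv hq hvb' hsum x
    rw [← hlaw] at h
    exact h.comp_of_map hωκ.aemeasurable
  have hε2 : ∫ w, ε w ^ 2 ∂μ = 1 := by
    rw [← variance_of_integral_eq_zero hε.aemeasurable hε_mean, hε_var]
  have hZ' : ∀ x, Z x = fun w => ε w * zonalWave v q x (ω w, κ w) := fun x => funext (hZ x)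
  have hmem : ∀ x, MemLp (Z x) 2 μ := fun x => by
    have hm : Measurable (Z x) := by
      rw [hZ']
      exact hε.mul ((hgm x).comp hωκ)
    rw [memLp_two_iff_integrable_sq hm.aestronglyMeasurable]
    have hi : IndepFun (fun w => ε w ^ 2) (fun w => zonalWave v q x (ω w, κ w) ^ 2) μ :=
      hi1.comp (φ := fun e : ℝ => e ^ 2) (ψ := fun p => zonalWave v q x p ^ 2)
        (by fun_prop) ((hgm x).pow_const 2)
    refine (hi.integrable_mul hε_sq.integrable_sq (hgL x).integrable_sq).congr
      (.of_forall fun w => ?_)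
    simp only [hZ, mul_pow, Pi.mul_apply]
  have hmean : ∀ x, ∫ w, Z x w ∂μ = 0 := fun x => by
    simp only [hZ]
    rw [hi1.integral_fun_comp_mul_comp (f := fun e => e) (g := zonalWave v q x)
      hε.aemeasurable hωκ.aemeasurable measurable_id.aestronglyMeasurable
      (hgm x).aestronglyMeasurable, hε_mean, zero_mul]
  have hpart : IsIsotropicPart μ Z (fun θ => ∑' n, b n * (q n).eval (Real.cos θ)) := by
    constructor
    -- Weierstrass M-test, dominated by the values at `1`.
    · exact continuousOn_tsum (fun n => by fun_prop) hsum (fun n θ _ => hbound n θ)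
    · intro x y
      rw [covariance_eq_sub (hmem x) (hmem y), hmean x, zero_mul, sub_zero, cos_geodesicDist,
        ← integral_zonalWave_mul_zonalWave hv hq hvb' hsum, ← hlaw,
        integral_map hωκ.aemeasurable ((hgm x).fun_mul (hgm y)).aestronglyMeasurable]
      have h := hi1.integral_fun_comp_mul_comp (f := fun e => e ^ 2)
        (g := fun p => zonalWave v q x p * zonalWave v q y p)
        hε.aemeasurable hωκ.aemeasurable (measurable_id.pow_const 2).aestronglyMeasurable
        ((hgm x).mul (hgm y)).aestronglyMeasurable
      rw [hε2, one_mul] at h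
      rw [← h]
      congr 1 with w
      simp only [hZ, Pi.mul_apply]
      ring
  exact ⟨fun θ => hsum.of_norm_bounded fun n => hbound n θ, ⟨hmem, ⟨0, hmean⟩, ⟨_, hpart⟩⟩,
    hmean, hpart⟩

theorem cosineWave_isIsotropic {ω : Ω → UnitSphere 1}
    (hε : Measurable ε) (hω : Measurable ω) (hκ : Measurable κ)
    (hε_sq : MemLp ε 2 μ) (hε_mean : ∫ w, ε w ∂μ = 0) (hε_var : variance ε μ = 1)
    (hω_unif : μ.map ω = sphereUniform 1)
    (hindep : iIndep ![MeasurableSpace.comap ε inferInstance,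
      MeasurableSpace.comap ω inferInstance, MeasurableSpace.comap κ inferInstance] μ)
    {a b : ℕ → ℝ} (hκ_law : ∀ n, μ.real {w | κ w = n} = a n)
    (hsupp : Function.support b ⊆ Function.support a) (hb : ∀ n, 0 ≤ b n) (hsum : Summable b) :
    (∀ θ : ℝ, Summable fun n : ℕ => b n * Real.cos (n * θ)) ∧
      IsIsotropic μ (cosineWave (fun n => if n = 0 then 1 else 2) a b ε ω κ) ∧
      (∀ x, ∫ w, cosineWave (fun n => if n = 0 then 1 else 2) a b ε ω κ x w ∂μ = 0) ∧
      IsIsotropicPart μ (cosineWave (fun n => if n = 0 then 1 else 2) a b ε ω κ)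
        (fun θ => ∑' n : ℕ, b n * Real.cos (n * θ)) := by
  have hc : ∀ n : ℕ, (0 : ℝ) < if n = 0 then 1 else 2 := fun n => by split_ifs <;> norm_num
  have ha : ∀ n, 0 ≤ a n := fun n => by
    rw [← hκ_law]
    exact measureReal_nonneg
  have hT : ∀ (n : ℕ) (θ : ℝ), Real.cos (n * θ) = (Chebyshev.T ℝ n).eval (Real.cos θ) :=
    fun n θ => by simp [Chebyshev.T_real_cos]
  simp only [hT]
  refine isIsotropic_of_eq_zonalWave le_rfl hε hω hκ hε_sq hε_mean hε_var hω_unif hindep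
    (v := fun n => (if n = 0 then 1 else 2) * b n / a n) (γ := fun n => (if n = 0 then 1 else 2)⁻¹)
    (q := fun n => Chebyshev.T ℝ n) hb
    (fun n => div_nonneg (mul_nonneg (hc n).le (hb n)) (ha n)) (fun n => inv_pos.2 (hc n))
    (fun n x y => integral_chebyshev_mul_chebyshev x y n) (fun n => ?_) (by simpa using hsum)
    (fun x w => ?_)
  · rw [hκ_law]
    -- Where `a n = 0`, the support condition forces `b n = 0`, and both sides are zero.
    by_cases h : b n = 0
    · simp [h]
    · have h1 : a n ≠ 0 := hsupp h
      have h2 := (hc n).ne'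
      field_simp
  · simp only [cosineWave, zonalWave, hT, cos_geodesicDist, mul_assoc]

theorem cosineWave_two_isIsotropic {ω : Ω → UnitSphere 1}
    (hε : Measurable ε) (hω : Measurable ω) (hκ : Measurable κ)
    (hε_sq : MemLp ε 2 μ) (hε_mean : ∫ w, ε w ∂μ = 0) (hε_var : variance ε μ = 1)
    (hω_unif : μ.map ω = sphereUniform 1)
    (hindep : iIndep ![MeasurableSpace.comap ε inferInstance,
      MeasurableSpace.comap ω inferInstance, MeasurableSpace.comap κ inferInstance] μ)
    {a b : ℕ → ℝ} (hκ_law : ∀ n, μ.real {w | κ w = n} = a n)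
    (hsupp : Function.support b ⊆ Function.support a) (hb : ∀ n, 0 ≤ b n) (hsum : Summable b) :
    IsIsotropic μ (cosineWave (fun _ => 2) a b ε ω κ) ∧
      (∀ x, ∫ w, cosineWave (fun _ => 2) a b ε ω κ x w ∂μ = 0) ∧
      IsIsotropicPart μ (cosineWave (fun _ => 2) a b ε ω κ)
        (fun θ => b 0 + ∑' n : ℕ, b n * Real.cos (n * θ)) := by
  -- Doubling the coefficient of degree `0` turns the standard weights into the constant weight `2`,
  -- so the previous theorem applies to `b'`.
  set b' : ℕ → ℝ := fun n => b n + if n = 0 then b 0 else 0 with hb'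
  have hb'0 : ∀ n, 0 ≤ b' n := fun n => by
    have := hb n
    have := hb 0
    simp only [hb']
    split_ifs <;> positivity
  have hs0 : HasSum (fun n : ℕ => if n = 0 then b 0 else 0) (b 0) := hasSum_ite_eq 0 (b 0)
  have hsupp' : Function.support b' ⊆ Function.support a := fun n hn => by
    refine hsupp fun h => hn ?_
    by_cases h0 : n = 0
    · subst h0
      simp [hb', h]
    · simp [hb', h, h0]
  have hwave : cosineWave (fun n => if n = 0 then 1 else 2) a b' ε ω κ =
      cosineWave (fun _ => 2) a b ε ω κ := by
    funext x w
    have : (if κ w = 0 then 1 else 2) * b' (κ w) = 2 * b (κ w) := by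
      simp only [hb']
      split_ifs with h
      · rw [h]
        ring
      · ring
    simp only [cosineWave, this]
  obtain ⟨-, h1, h2, h3⟩ := cosineWave_isIsotropic hε hω hκ hε_sq hε_mean hε_var hω_unif hindep
    hκ_law hsupp' hb'0 (hsum.add hs0.summable)
  obtain ⟨hS, -⟩ := cosineWave_isIsotropic hε hω hκ hε_sq hε_mean hε_var hω_unif hindep
    hκ_law hsupp hb hsum
  rw [hwave] at h1 h2 h3
  refine ⟨h1, h2, ?_⟩
  convert h3 using 2 with θ
  refine (add_comm _ _).trans (((hS θ).hasSum.add hs0).tsum_eq.symm.trans ?_)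
  congr 1 with n
  simp only [hb']
  split_ifs with h
  · simp [h]
  · simp

theorem gegenbauerWave_isIsotropic (hd : 2 ≤ d)
    (hε : Measurable ε) (hω : Measurable ω) (hκ : Measurable κ)
    (hε_sq : MemLp ε 2 μ) (hε_mean : ∫ w, ε w ∂μ = 0) (hε_var : variance ε μ = 1)
    (hω_unif : μ.map ω = sphereUniform d)
    (hindep : iIndep ![MeasurableSpace.comap ε inferInstance,
      MeasurableSpace.comap ω inferInstance, MeasurableSpace.comap κ inferInstance] μ)
    {a b : ℕ → ℝ} (hκ_law : ∀ n, μ.real {w | κ w = n} = a n)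
    (hsupp : Function.support b ⊆ Function.support a) (hb : IsSchoenbergSequence d b) :
    (∀ θ : ℝ, Summable fun n : ℕ =>
        b n * (gegenbauer (((d : ℝ) - 1) / 2) n).eval (Real.cos θ)) ∧
      IsIsotropic μ (gegenbauerWave a b ε ω κ) ∧
      (∀ x, ∫ w, gegenbauerWave a b ε ω κ x w ∂μ = 0) ∧
      IsIsotropicPart μ (gegenbauerWave a b ε ω κ)
        (fun θ => ∑' n : ℕ, b n * (gegenbauer (((d : ℝ) - 1) / 2) n).eval (Real.cos θ)) := by
  have hd' : (0 : ℝ) < d - 1 := by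
    have : (2 : ℝ) ≤ d := by exact_mod_cast hd
    linarith
  have hc : ∀ n : ℕ, (0 : ℝ) < 2 * n + d - 1 := fun n => by
    have : (0 : ℝ) ≤ n := Nat.cast_nonneg n
    linarith
  have ha : ∀ n, 0 ≤ a n := fun n => by
    rw [← hκ_law]
    exact measureReal_nonneg
  refine isIsotropic_of_eq_zonalWave (by omega) hε hω hκ hε_sq hε_mean hε_var hω_unif hindep
    (v := fun n => b n * (2 * (n : ℝ) + d - 1) / (a n * ((d : ℝ) - 1)))
    (γ := fun n => ((d : ℝ) - 1) / (2 * n + d - 1)) hb.nonneg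
    (fun n => div_nonneg (mul_nonneg (hb.nonneg n) (hc n).le) (mul_nonneg (ha n) hd'.le))
    (fun n => div_pos hd' (hc n))
    (fun n x y => integral_gegenbauer_mul_gegenbauer hd x y n) (fun n => ?_) hb.summable
    (fun x w => ?_)
  · rw [hκ_law]
    by_cases h : b n = 0
    · simp [h]
    · have h1 : a n ≠ 0 := hsupp h
      have h2 := (hc n).ne'
      have h3 := hd'.ne'
      field_simp
  · simp only [gegenbauerWave, zonalWave, mul_assoc]

end Field

end

theorem proposition1 {Ω : Type*} [MeasurableSpace Ω] (μ : Measure Ω) [IsProbabilityMeasure μ]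
    (d : ℕ) (a b : ℕ → ℝ) (hb : IsSchoenbergSequence d b)
    (ε : Ω → ℝ) (ω : Ω → UnitSphere d) (κ : Ω → ℕ)
    (hε : Measurable ε) (hω : Measurable ω) (hκ : Measurable κ)
    (hε_sq : MemLp ε 2 μ) (hε_mean : ∫ w, ε w ∂μ = 0) (hε_var : variance ε μ = 1)
    (hω_unif : μ.map ω = sphereUniform d)
    (hκ_law : ∀ n, μ.real {w | κ w = n} = a n)
    (hsupp : Function.support b ⊆ Function.support a)
    (hindep : iIndep ![MeasurableSpace.comap ε inferInstance,
      MeasurableSpace.comap ω inferInstance, MeasurableSpace.comap κ inferInstance] μ) :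
    (d = 1 →
      (∀ θ ∈ Set.Icc 0 Real.pi, Summable fun n : ℕ => b n * Real.cos (n * θ)) ∧
      -- the wave with normalizing factor `1` in degree `0` and `2` in positive degrees
      (IsIsotropic μ (cosineWave (fun n => if n = 0 then 1 else 2) a b ε ω κ) ∧
        (∀ x, ∫ w, cosineWave (fun n => if n = 0 then 1 else 2) a b ε ω κ x w ∂μ = 0) ∧
        IsIsotropicPart μ (cosineWave (fun n => if n = 0 then 1 else 2) a b ε ω κ)
          (fun θ => ∑' n : ℕ, b n * Real.cos (n * θ))) ∧
      -- the wave with factor `2` in every degree, which counts the degree `0` term twice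
      (IsIsotropic μ (cosineWave (fun _ => 2) a b ε ω κ) ∧
        (∀ x, ∫ w, cosineWave (fun _ => 2) a b ε ω κ x w ∂μ = 0) ∧
        IsIsotropicPart μ (cosineWave (fun _ => 2) a b ε ω κ)
          (fun θ => b 0 + ∑' n : ℕ, b n * Real.cos (n * θ)))) ∧
    (2 ≤ d →
      (∀ θ ∈ Set.Icc 0 Real.pi, Summable fun n : ℕ =>
        b n * (gegenbauer (((d : ℝ) - 1) / 2) n).eval (Real.cos θ)) ∧
      IsIsotropic μ (gegenbauerWave a b ε ω κ) ∧
      (∀ x, ∫ w, gegenbauerWave a b ε ω κ x w ∂μ = 0) ∧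
      IsIsotropicPart μ (gegenbauerWave a b ε ω κ)
        (fun θ => ∑' n : ℕ, b n * (gegenbauer (((d : ℝ) - 1) / 2) n).eval (Real.cos θ))) := by
  constructor
  · rintro rfl
    have hsum : Summable b := by simpa [gegenbauer] using hb.summable
    obtain ⟨h1, h2⟩ := cosineWave_isIsotropic hε hω hκ hε_sq hε_mean hε_var hω_unif hindep
      hκ_law hsupp hb.nonneg hsum
    exact ⟨fun θ _ => h1 θ, h2, cosineWave_two_isIsotropic hε hω hκ hε_sq hε_mean hε_var hω_unif
      hindep hκ_law hsupp hb.nonneg hsum⟩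
  · intro hd
    obtain ⟨h1, h2⟩ := gegenbauerWave_isIsotropic hd hε hω hκ hε_sq hε_mean hε_var hω_unif hindep
      hκ_law hsupp hb
    exact ⟨fun θ _ => h1 θ, h2⟩
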